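/- A group $G$ is called capable if there is a group $K$ such that $G \cong K/Z(K)$, where $Z(K)$ is the centre of $K$. Let $p$ be an odd prime, and let $G_1$ and $G_2$ be finite noncyclic $p$-groups of nilpotency class at most $2$ and exponent $p$. Then the direct sum (direct product) $G_1 \oplus G_2$ is capable if and only if both $G_1$ and $G_2$ are capable. -/

import Mathlib

universe u v

/-- A group `G` is *capable* if it is isomorphic to the central quotient `K / Z(K)` of some
group `K`.  Taking `K` in the universe of `G` is no restriction: if `K / Z(K) ≅ G`, lifts to `K` of
the elements of `G` generate a subgroup `H` of `K` with `H Z(K) = K`, so that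
`Z(H) = H ∩ Z(K)` and `H / Z(H) ≅ G`, and the cardinality of `H` is at most `max (#G) ℵ₀`. -/
def IsCapable (G : Type u) [Group G] : Prop :=
  ∃ (K : Type u) (_ : Group K), Nonempty (K ⧸ Subgroup.center K ≃* G)

open Subgroup
open scoped commutatorElement

universe w

section Capable

variable {G : Type u} [Group G]

/-! Products of capable groups are capable because centres multiply. Conversely, a group is capable
once each `x ≠ 1` has a noncentral lift in some central extension, so `G₁` can be treated one
element at a time. Outside the derived subgroup, the abelianization is a noncyclic `F_p`-space, and
two functionals on it give a Heisenberg-type extension that detects `x`. Inside it, the witness for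
`G₁ × G₂` is restricted to the preimage of `G₁`. -/

theorem isCapable_iff_exists_ker_eq_center :
    IsCapable G ↔ ∃ (K : Type u) (_ : Group K) (π : K →* G),
      Function.Surjective π ∧ π.ker = center K := by
  constructor
  · rintro ⟨K, _, ⟨e⟩⟩
    refine ⟨K, _, e.toMonoidHom.comp (QuotientGroup.mk' (center K)),
      e.surjective.comp (QuotientGroup.mk'_surjective _), ?_⟩
    ext k
    simp
  · rintro ⟨K, _, π, hπ, hker⟩
    exact ⟨K, _, ⟨(QuotientGroup.quotientMulEquivOfEq hker.symm).trans
      (QuotientGroup.quotientKerEquivOfSurjective π hπ)⟩⟩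

theorem IsCapable.prod {H : Type v} [Group H] (hG : IsCapable G) (hH : IsCapable H) :
    IsCapable (G × H) := by
  obtain ⟨K, _, π, hπ, hker⟩ := isCapable_iff_exists_ker_eq_center.1 hG
  obtain ⟨L, _, ρ, hρ, hker'⟩ := isCapable_iff_exists_ker_eq_center.1 hH
  refine isCapable_iff_exists_ker_eq_center.2
    ⟨K × L, inferInstance, π.prodMap ρ, hπ.prodMap hρ, ?_⟩
  ext ⟨k, l⟩
  have hk : π k = 1 ↔ k ∈ center K := by rw [← hker, MonoidHom.mem_ker]
  have hl : ρ l = 1 ↔ l ∈ center L := by rw [← hker', MonoidHom.mem_ker]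
  rw [MonoidHom.mem_ker, MonoidHom.prodMap_def, MonoidHom.prod_apply, Prod.mk_eq_one]
  change π k = 1 ∧ ρ l = 1 ↔ _
  rw [hk, hl]
  simp only [mem_center_iff, Prod.forall, Prod.mk_mul_mk, Prod.mk.injEq]
  exact ⟨fun h a b => ⟨h.1 a, h.2 b⟩, fun h => ⟨fun a => (h a 1).1, fun b => (h 1 b).2⟩⟩

theorem IsCapable.of_mulEquiv {H : Type u} [Group H] (hG : IsCapable G) (e : G ≃* H) :
    IsCapable H := by
  obtain ⟨K, _, ⟨f⟩⟩ := hG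
  exact ⟨K, _, ⟨f.trans e⟩⟩

/-- Some central extension of `G` by a group in `Type w` has a noncentral element over `x`,
i.e. `x` lies outside the epicentre of `G`. -/
def HasNoncentralLift (G : Type u) [Group G] (x : G) : Prop :=
  ∃ (K : Type w) (_ : Group K) (π : K →* G), Function.Surjective π ∧ π.ker ≤ center K ∧
    ∃ k l : K, π k = x ∧ k * l ≠ l * k

/-- The central extension can be taken to be a quotient of the free group on `G`, hence in the
universe of `G`. -/
theorem HasNoncentralLift.lower_universe {x : G} (h : HasNoncentralLift.{u, w} G x) :
    HasNoncentralLift.{u, u} G x := by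
  obtain ⟨K, _, π, hπ, hker, k, l, rfl, hkl⟩ := h
  choose s hs using hπ
  have central : ∀ z, π z = 1 → ∀ a, a * z = z * a := fun z hz => mem_center_iff.1 (hker hz)
  let φ : FreeGroup G →* K := FreeGroup.lift s
  have hφ : ∀ g, φ (FreeGroup.of g) = s g := fun g => FreeGroup.lift_apply_of
  let ψ : FreeGroup G ⧸ φ.ker →* K := QuotientGroup.kerLift φ
  have hψ : Function.Injective ψ := QuotientGroup.kerLift_injective φ
  refine ⟨FreeGroup G ⧸ φ.ker, inferInstance, π.comp ψ, fun g => ⟨(FreeGroup.of g : FreeGroup G),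
    ?_⟩, fun z hz => mem_center_iff.2 fun a => hψ ?_, (FreeGroup.of (π k) : FreeGroup G),
    (FreeGroup.of (π l) : FreeGroup G), ?_, fun hcomm => hkl ?_⟩
  · change π (φ (FreeGroup.of g)) = g
    rw [hφ, hs]
  · rw [map_mul, map_mul]
    exact central _ hz _
  · change π (φ (FreeGroup.of _)) = _
    rw [hφ, hs]
  · have hst : s (π k) * s (π l) = s (π l) * s (π k) := by
      have := congrArg ψ hcomm
      rw [map_mul, map_mul] at this
      change φ (FreeGroup.of _) * φ (FreeGroup.of _) = φ (FreeGroup.of _) * φ (FreeGroup.of _)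
        at this
      simpa only [hφ] using this
    have hz : ∀ m : K, π ((s (π m))⁻¹ * m) = 1 := fun m => by simp [hs]
    have hk := central _ (hz k)
    have hl := central _ (hz l)
    set z := (s (π k))⁻¹ * k with hzk
    set y := (s (π l))⁻¹ * l with hyl
    have ek : k = s (π k) * z := by simp [hzk]
    have el : l = s (π l) * y := by simp [hyl]
    rw [ek, el]
    calc s (π k) * z * (s (π l) * y) = s (π k) * s (π l) * y * z := by
          rw [mul_assoc, ← hk]; simp only [mul_assoc]
      _ = s (π l) * y * (s (π k) * z) := by
          rw [hst, mul_assoc (s (π l)), hl]; simp only [mul_assoc]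

/-- Gluing the extensions of a family along `G` (their fibre product over `G`). -/
theorem isCapable_of_hasNoncentralLift (h : ∀ x : G, x ≠ 1 → HasNoncentralLift.{u, u} G x) :
    IsCapable G := by
  have h' : ∀ x : {x : G // x ≠ 1}, HasNoncentralLift.{u, u} G x := fun x => h x x.2
  choose K _ π hπ hker k l hk hkl using h'
  let P : Subgroup (G × ∀ x, K x) :=
    { carrier := {f | ∀ x, π x (f.2 x) = f.1}
      mul_mem' := fun {a b} ha hb x => by simp [ha x, hb x]
      one_mem' := fun x => by simp
      inv_mem' := fun {a} ha x => by simp [ha x] }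
  -- Since `P` projects onto each `K y`, central elements of `P` have central components.
  have hlift : ∀ (y : {x : G // x ≠ 1}) (m : K y), ∃ f : P, f.1.2 y = m := by
    classical
    intro y m
    choose s hs using fun x => hπ x (π y m)
    refine ⟨⟨(π y m, Function.update s y m), fun x => ?_⟩, Function.update_self ..⟩
    by_cases hxy : x = y
    · subst hxy
      simp
    · simp [Function.update_of_ne hxy, hs]
  refine isCapable_iff_exists_ker_eq_center.2
    ⟨P, inferInstance, (MonoidHom.fst _ _).comp P.subtype, fun g => ?_, le_antisymm ?_ ?_⟩
  · choose s hs using fun x => hπ x g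
    exact ⟨⟨(g, s), hs⟩, rfl⟩
  · intro f hf
    have hf1 : f.1.1 = 1 := hf
    refine mem_center_iff.2 fun a => Subtype.ext (Prod.ext ?_ (funext fun x => ?_))
    · change a.1.1 * f.1.1 = f.1.1 * a.1.1
      rw [hf1, one_mul, mul_one]
    · exact mem_center_iff.1 (hker x (show π x (f.1.2 x) = 1 from (f.2 x).trans hf1)) (a.1.2 x)
  · intro f hf
    by_contra hne
    let y : {x : G // x ≠ 1} := ⟨f.1.1, hne⟩
    have hfy : ∀ m : K y, m * f.1.2 y = f.1.2 y * m := by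
      intro m
      obtain ⟨a, rfl⟩ := hlift y m
      exact congrArg (fun c : P => c.1.2 y) (mem_center_iff.1 hf a)
    -- Two lifts of one element differ by a central factor, so `k y` would be central too.
    have hz : ∀ m : K y, m * ((f.1.2 y)⁻¹ * k y) = ((f.1.2 y)⁻¹ * k y) * m := by
      refine mem_center_iff.1 (hker y ?_)
      rw [MonoidHom.mem_ker, map_mul, map_inv, hk, f.2 y]
      exact inv_mul_cancel _
    apply hkl y
    calc k y * l y = f.1.2 y * ((f.1.2 y)⁻¹ * k y * l y) := by group
      _ = f.1.2 y * l y * ((f.1.2 y)⁻¹ * k y) := by rw [← hz, mul_assoc]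
      _ = l y * k y := by rw [← hfy, mul_assoc, mul_inv_cancel_left]

end Capable

section Heisenberg

variable {G : Type u} [Group G] {R : Type w} [CommRing R]

/-- The central extension of `G` by `R` with the bilinear cocycle `(a, b) ↦ f a * g b`. -/
@[ext]
structure BilinearExtension (f g : G →* Multiplicative R) where
  base : G
  fibre : R

namespace BilinearExtension

variable (f g : G →* Multiplicative R)

instance : Group (BilinearExtension f g) where
  mul a b := ⟨a.base * b.base, a.fibre + b.fibre + (f a.base).toAdd * (g b.base).toAdd⟩
  one := ⟨1, 0⟩
  inv a := ⟨a.base⁻¹, -a.fibre + (f a.base).toAdd * (g a.base).toAdd⟩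
  mul_assoc a b c := by
    refine BilinearExtension.ext (mul_assoc _ _ _) ?_
    change _ + _ + (f (_ * _)).toAdd * _ = _ + _ + _ * (g (_ * _)).toAdd
    change (_ + _ + _) + _ + _ = _ + (_ + _ + _) + _
    rw [map_mul f, map_mul g, toAdd_mul, toAdd_mul]
    ring
  one_mul a := by
    refine BilinearExtension.ext (one_mul _) ?_
    change 0 + _ + (f 1).toAdd * _ = _
    simp
  mul_one a := by
    refine BilinearExtension.ext (mul_one _) ?_
    change _ + 0 + _ * (g 1).toAdd = _
    simp
  inv_mul_cancel a := by
    refine BilinearExtension.ext (inv_mul_cancel _) ?_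
    change -a.fibre + (f a.base).toAdd * (g a.base).toAdd + a.fibre +
      (f a.base⁻¹).toAdd * (g a.base).toAdd = 0
    rw [map_inv f, toAdd_inv]
    ring

variable {f g}

theorem mul_base (a b : BilinearExtension f g) : (a * b).base = a.base * b.base := rfl

theorem mul_fibre (a b : BilinearExtension f g) :
    (a * b).fibre = a.fibre + b.fibre + (f a.base).toAdd * (g b.base).toAdd := rfl

variable (f g) in
/-- The projection of the extension onto `G`. -/
def proj : BilinearExtension f g →* G where
  toFun := base
  map_one' := rfl
  map_mul' _ _ := rfl

theorem ker_proj_le_center : (proj f g).ker ≤ center (BilinearExtension f g) := by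
  intro z hz
  have hz1 : z.base = 1 := hz
  refine mem_center_iff.2 fun a => BilinearExtension.ext ?_ ?_
  · simp [mul_base, hz1]
  · simp [mul_fibre, hz1, add_comm]

end BilinearExtension

theorem hasNoncentralLift_of_homs (f g : G →* Multiplicative R) {x y : G}
    (h : (f x).toAdd * (g y).toAdd ≠ (f y).toAdd * (g x).toAdd) :
    HasNoncentralLift.{u, max u w} G x := by
  refine ⟨BilinearExtension f g, inferInstance, BilinearExtension.proj f g,
    fun a => ⟨⟨a, 0⟩, rfl⟩, BilinearExtension.ker_proj_le_center, ⟨x, 0⟩, ⟨y, 0⟩, rfl,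
    fun hcomm => h ?_⟩
  simpa [BilinearExtension.mul_fibre] using congrArg BilinearExtension.fibre hcomm

end Heisenberg

section

variable {G : Type u} [Group G]

/-- In class at most 2 the derived subgroup is central, and a group with cyclic quotient by a
central subgroup is abelian. -/
theorem isCyclic_of_isCyclic_abelianization_of_nilpotencyClass_le_two [Group.IsNilpotent G]
    (hcl : Group.nilpotencyClass G ≤ 2) [IsCyclic (Abelianization G)] : IsCyclic G := by
  have hcen : (Abelianization.of (G := G)).ker ≤ center G := by
    rw [Abelianization.ker_of]
    intro c hc
    refine mem_center_iff.2 fun a => ?_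
    have hbot := Subgroup.lowerCentralSeries_eq_bot_iff_nilpotencyClass_le.2 hcl
    have hmem : c * a * c⁻¹ * a⁻¹ ∈ (⊤ : Subgroup G).lowerCentralSeries 2 :=
      commutator_mem_commutator (H₁ := (⊤ : Subgroup G).lowerCentralSeries 1) hc (mem_top a)
    rw [hbot, mem_bot, mul_inv_eq_one, mul_inv_eq_iff_eq_mul] at hmem
    exact hmem.symm
  have hcomm := (Abelianization.of.isMulCommutative_of_isCyclic_of_ker_le_center hcen).is_comm.comm
  refine isCyclic_of_injective (Abelianization.of (G := G)) ?_
  rw [← MonoidHom.ker_eq_bot_iff, Abelianization.ker_of, _root_.commutator_def, eq_bot_iff,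
    commutator_le]
  intro a _ b _
  rw [mem_bot, commutatorElement_eq_one_iff_mul_comm]
  exact hcomm a b

theorem exists_addMonoidHom_pair_of_forall_smul_ne {k V : Type*} [Field k] [AddCommGroup V]
    [Module k V] {v w : V} (hv : v ≠ 0) (hw : ∀ c : k, c • v ≠ w) :
    ∃ f g : V →+ k, f v ≠ 0 ∧ g v = 0 ∧ g w ≠ 0 := by
  obtain ⟨f, hf⟩ : ∃ f : Module.Dual k V, f v ≠ 0 := by
    by_contra! h
    exact hv ((Module.forall_dual_apply_eq_zero_iff k v).1 h)
  have hw' : w ∉ Submodule.span k {v} := fun h =>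
    (Submodule.mem_span_singleton.1 h).elim fun c hc => hw c hc
  obtain ⟨g, hg, hgv⟩ := Submodule.exists_le_ker_of_notMem hw'
  exact ⟨f.toAddMonoidHom, g.toAddMonoidHom, hf, hgv (Submodule.mem_span_singleton_self v), hg⟩

theorem hasNoncentralLift_of_notMem_commutator {p : ℕ} [Fact p.Prime]
    (hexp : Monoid.exponent G = p) (hab : ¬ IsCyclic (Abelianization G)) {x : G}
    (hx : x ∉ commutator G) : HasNoncentralLift.{u, u} G x := by
  let _ : Module (ZMod p) (Additive (Abelianization G)) := AddCommGroup.zmodModule fun v => by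
    obtain ⟨a, ha⟩ := QuotientGroup.mk_surjective v.toMul
    have ha : Abelianization.of a = v.toMul := ha
    apply Additive.toMul.injective
    rw [toMul_nsmul, ← ha, ← map_pow, ← hexp, Monoid.pow_exponent_eq_one, map_one, toMul_zero]
  let q : G →* Multiplicative (Additive (Abelianization G)) :=
    (Abelianization.of : G →* Abelianization G)
  have hq : Function.Surjective q := QuotientGroup.mk_surjective
  have hv : (q x).toAdd ≠ 0 := fun h => hx (by
    rw [← Abelianization.ker_of]
    exact h)
  -- Otherwise the image of `x` would generate the abelianization.
  obtain ⟨w, hw⟩ : ∃ w : Additive (Abelianization G), ∀ c : ZMod p, c • (q x).toAdd ≠ w := by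
    by_contra! h
    refine hab ⟨(q x).toAdd.toMul, fun a => ?_⟩
    obtain ⟨c, hc⟩ := h (Additive.ofMul a)
    obtain ⟨n, rfl⟩ := ZMod.intCast_surjective c
    rw [Int.cast_smul_eq_zsmul] at hc
    exact ⟨n, congrArg Additive.toMul hc⟩
  obtain ⟨f, g, hf, hgv, hb⟩ := exists_addMonoidHom_pair_of_forall_smul_ne hv hw
  obtain ⟨y, hy⟩ := hq (Multiplicative.ofAdd w)
  obtain rfl : (q y).toAdd = w := by rw [hy, toAdd_ofAdd]
  refine (hasNoncentralLift_of_homs.{u, 0} (f.toMultiplicative.comp q)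
    (g.toMultiplicative.comp q) (x := x) (y := y) ?_).lower_universe
  change f (q x).toAdd * g (q y).toAdd ≠ f (q y).toAdd * g (q x).toAdd
  rw [hgv, mul_zero]
  exact mul_ne_zero hf hb

/-- If `m` commutes with `L` modulo the centre, then `a ↦ ⁅a, m⁆` is a homomorphism from `L` to an
abelian group, so `m` centralizes the derived subgroup of `L`. -/
theorem mul_comm_of_mem_commutator {K : Type*} [Group K] {L : Subgroup K} {m : K}
    (h : ∀ a : L, ⁅(a : K), m⁆ ∈ center K) {c : L} (hc : c ∈ _root_.commutator L) :
    (c : K) * m = m * c := by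
  let θ : L →* center K :=
    { toFun := fun a => ⟨⁅(a : K), m⁆, h a⟩
      map_one' := Subtype.ext (by simp)
      map_mul' := fun a b => Subtype.ext (by
        have hb := mem_center_iff.1 (h b) a
        change ⁅(a : K) * b, m⁆ = ⁅(a : K), m⁆ * ⁅(b : K), m⁆
        calc ⁅(a : K) * b, m⁆ = (a * ⁅(b : K), m⁆) * (m * (a : K)⁻¹ * m⁻¹) := by
              simp only [commutatorElement_def]; group
          _ = ⁅(b : K), m⁆ * ⁅(a : K), m⁆ := by
              rw [hb]; simp only [commutatorElement_def]; group
          _ = _ := mem_center_iff.1 (h a) _) }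
  have hker : _root_.commutator L ≤ θ.ker := commutator_le.2 fun a _ b _ => by
    rw [MonoidHom.mem_ker, map_commutatorElement, commutatorElement_eq_one_iff_mul_comm]
    exact Subtype.ext (mem_center_iff.1 (θ b).2 (θ a))
  have hθ : θ c = 1 := hker hc
  exact commutatorElement_eq_one_iff_mul_comm.1 (congrArg Subtype.val hθ)

/-- The preimage `L` of `G` centralizes the preimage of `H` modulo the centre, so the latter
centralizes the derived subgroup of `L`. A lift of `x` in that subgroup, if central in `L`, would be
central in the whole witness. -/
theorem IsCapable.hasNoncentralLift_of_mem_commutator {H : Type v} [Group H]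
    (h : IsCapable (G × H)) {x : G} (hx : x ∈ commutator G) (hx1 : x ≠ 1) :
    HasNoncentralLift.{u, u} G x := by
  obtain ⟨K, _, π, hπ, hker⟩ := isCapable_iff_exists_ker_eq_center.1 h
  have central : ∀ z, π z = 1 → ∀ a, a * z = z * a :=
    fun z hz => mem_center_iff.1 (hker ▸ hz : z ∈ center K)
  let L : Subgroup K := ((MonoidHom.snd G H).comp π).ker
  let ρ : L →* G := ((MonoidHom.fst G H).comp π).comp L.subtype
  have hπL : ∀ a : L, π a = (ρ a, 1) := fun a => Prod.ext rfl a.2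
  have hρ : Function.Surjective ρ := fun g => by
    obtain ⟨a, ha⟩ := hπ (g, 1)
    exact ⟨⟨a, congrArg Prod.snd ha⟩, congrArg Prod.fst ha⟩
  obtain ⟨c, hc, hcx⟩ : ∃ c ∈ commutator L, ρ c = x := by
    have : (commutator L).map ρ = commutator G := by
      rw [_root_.commutator_def, map_commutator, ← MonoidHom.range_eq_map,
        MonoidHom.range_eq_top.2 hρ, _root_.commutator_def]
    rwa [← this] at hx
  refine HasNoncentralLift.lower_universe.{u, max u v} ⟨L, inferInstance, ρ, hρ, ?_, c, ?_⟩
  · intro z hz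
    have hz1 : π z = 1 := by rw [hπL, show ρ z = 1 from hz]; rfl
    exact mem_center_iff.2 fun a => Subtype.ext (central _ hz1 a)
  by_contra! hcomm
  have hcL : ∀ l : L, c * l = l * c := fun l => hcomm l hcx
  have hcc : (c : K) ∉ center K := fun hcen => hx1 (by
    rw [← hker, MonoidHom.mem_ker, hπL, hcx] at hcen
    exact congrArg Prod.fst hcen)
  apply hcc
  refine mem_center_iff.2 fun k => ?_
  obtain ⟨l, hl⟩ := hρ (π k).1
  -- Splits `k` as an element of `L` times one lying over `H`.
  let m : K := (l : K)⁻¹ * k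
  have hm : (π m).1 = 1 := by simp [m, hπL, hl]
  have hcentral : ∀ a : L, ⁅(a : K), m⁆ ∈ center K := fun a => by
    rw [← hker, MonoidHom.mem_ker, map_commutatorElement, commutatorElement_eq_one_iff_mul_comm,
      hπL]
    refine Prod.ext ?_ ?_ <;> simp [hm]
  have hcm := mul_comm_of_mem_commutator hcentral hc
  have hcl : (c : K) * l = l * c := congrArg Subtype.val (hcL l)
  have hk : k = l * m := by simp [m]
  rw [hk, mul_assoc, ← hcm, ← mul_assoc, ← hcl, mul_assoc]

theorem IsCapable.of_prod_left {p : ℕ} (hp : p.Prime) {H : Type v} [Group H]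
    [Group.IsNilpotent G] (hcl : Group.nilpotencyClass G ≤ 2) (hexp : Monoid.exponent G = p)
    (hnc : ¬ IsCyclic G) (h : IsCapable (G × H)) : IsCapable G := by
  have : Fact p.Prime := ⟨hp⟩
  refine isCapable_of_hasNoncentralLift fun x hx1 => ?_
  by_cases hx : x ∈ commutator G
  · exact h.hasNoncentralLift_of_mem_commutator hx hx1
  · exact hasNoncentralLift_of_notMem_commutator hexp
      (fun _ => hnc (isCyclic_of_isCyclic_abelianization_of_nilpotencyClass_le_two hcl)) hx

end

theorem mainTheorem12 (p : ℕ) (hp : p.Prime) (hp2 : p ≠ 2)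
    (G₁ : Type u) (G₂ : Type v) [Group G₁] [Group G₂] [Finite G₁] [Finite G₂]
    [Group.IsNilpotent G₁] [Group.IsNilpotent G₂]
    (hcl₁ : Group.nilpotencyClass G₁ ≤ 2) (hcl₂ : Group.nilpotencyClass G₂ ≤ 2)
    (hexp₁ : Monoid.exponent G₁ = p) (hexp₂ : Monoid.exponent G₂ = p)
    (hnc₁ : ¬ IsCyclic G₁) (hnc₂ : ¬ IsCyclic G₂) :
    IsCapable (G₁ × G₂) ↔ IsCapable G₁ ∧ IsCapable G₂ :=
  ⟨fun h => ⟨h.of_prod_left hp hcl₁ hexp₁ hnc₁,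
    (h.of_mulEquiv MulEquiv.prodComm).of_prod_left hp hcl₂ hexp₂ hnc₂⟩, fun h => h.1.prod h.2⟩
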